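/- **Conventions.** All rings are commutative, noetherian, $F$-finite $\mathbb F_p$-algebras; $q=p^e$ with $e\ge 1$ fixed. A *Cartier pair* $(R,\phi)$ is a ring $R$ with an additive map $\phi:R\to R$ such that $\phi(r^{q}x)=r\,\phi(x)$, i.e. $\phi\in\operatorname{Hom}_R(F^e_*R,R)$. A *homomorphism* $\theta:(R,\phi)\to(S,\psi)$ is a ring homomorphism with $\theta\circ\phi=\psi\circ\theta$; we write $\mathfrak b\cap R=\theta^{-1}(\mathfrak b)$, $f:\operatorname{Spec}S\to\operatorname{Spec}R$, $\mathfrak q\mapsto\mathfrak q\cap R$. A $\phi$-*ideal* is an ideal $\mathfrak a$ with $\phi(\mathfrak a)\subseteq\mathfrak a$. For an ideal $\mathfrak a$ put $\mathfrak a^{\phi^n}=\{x:\phi^n(xR)\subseteq\mathfrak a\}$, $\kappa_{\mathfrak a}(R,\phi)=\bigcap_{n\ge1}\mathfrak a^{\phi^n}$ and $\beta_{\mathfrak a}(R,\phi)=\mathfrak a\cap\kappa_{\mathfrak a}(R,\phi)$. Let $\operatorname{CSpec}(R,\phi)$ be the set of prime $\phi$-ideals, and let $\operatorname{Schpec}(R,\phi)$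 be the set of those $\mathfrak p\in\operatorname{CSpec}(R,\phi)$ for which the map $F^e_*\kappa(\mathfrak p)\to\kappa(\mathfrak p)$ induced by $\phi$ on the residue field is nonzero; both carry the subspace topology of $\operatorname{Spec}R$. Let $\operatorname{CZpec}(R,\phi)$ be the set $\operatorname{Spec}R$ with the topology whose closed sets are the $V(\mathfrak a)$, $\mathfrak a$ a $\phi$-ideal, and $\mathcal U(R,\phi)=\{\mathfrak p:\kappa_{\mathfrak p}(R,\phi)\ne R\}\subseteq\operatorname{CZpec}(R,\phi)$. The map $\mathfrak p\mapsto\beta_{\mathfrak p}$ is a retraction $\beta:\operatorname{CZpec}(R,\phi)\to\operatorname{CSpec}(R,\phi)$. Contraction of primes gives maps $h=\operatorname{CZpec}\theta:\operatorname{CZpec}(S,\psi)\to\operatorname{CZpec}(R,\phi)$ and $g=\operatorname{CSpec}\theta:\operatorname{CSpec}(S,\psi)\to\operatorname{CSpec}(R,\phi)$. A ring homomorphism is *Cohen–Seidenberg* if it satisfies incomparability, going-up and going-down. We call $\theta$ *quasi-fibered* if $h$ is continuous, and *fibered* if moreover $h^{-1}\mathcal U(R,\phi)=\mathcal U(S,\psi)$.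 **Theorem.** Let $\theta:(R,\phi)\to(S,\psi)$ be a homomorphism of Cartier pairs. 0. For all primes $\mathfrak q$ of $S$, $\beta_{\mathfrak q}(S,\psi)\cap R\subseteq\beta_{\mathfrak q\cap R}(R,\phi)$ and $\kappa_{\mathfrak q}(S,\psi)\cap R\subseteq\kappa_{\mathfrak q\cap R}(R,\phi)$. Moreover $\operatorname{CSpec}(S,\psi)\subseteq f^{-1}\operatorname{CSpec}(R,\phi)$, $h^{-1}\mathcal U(R,\phi)\subseteq\mathcal U(S,\psi)$ and $g^{-1}\operatorname{Schpec}(R,\phi)\subseteq\operatorname{Schpec}(S,\psi)$. 1. The following are equivalent: (a) $\theta$ is quasi-fibered; (b) $g\circ\beta(S,\psi)=\beta(R,\phi)\circ h$; (c) $\beta_{\mathfrak q}(S,\psi)\cap R=\beta_{\mathfrak q\cap R}(R,\phi)$ for all primes $\mathfrak q$ of $S$; (d) $\sqrt{\beta_{\mathfrak a}(R,\phi)S}\subseteq\beta_{\sqrt{\mathfrak aS}}(S,\psi)$ for all ideals $\mathfrak a$ of $R$; (e) the same for all primes $\mathfrak a=\mathfrak p$ of $R$. 2. If $\theta$ is Cohen–Seidenberg,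 the following are also equivalent to $\theta$ being quasi-fibered: equality in (d) for all radical ideals $\mathfrak a$; equality in (e) for all primes $\mathfrak p$; $f^{-1}\{\beta_{\mathfrak p}(R,\phi)\}=\beta(S,\psi)(f^{-1}\{\mathfrak p\})$ for all primes $\mathfrak p$ of $R$; $\operatorname{CSpec}(S,\psi)=f^{-1}\operatorname{CSpec}(R,\phi)$. 3. If $\theta$ is quasi-fibered, the following are equivalent: $\theta$ is fibered; $h^{-1}\mathcal U(R,\phi)=\mathcal U(S,\psi)$; $g^{-1}\operatorname{Schpec}(R,\phi)=\operatorname{Schpec}(S,\psi)$; contraction of primes and the retractions $\beta$ restrict to a commutative square of continuous maps with horizontal arrows $\mathcal U(S,\psi)\to\mathcal U(R,\phi)$, $\operatorname{Schpec}(S,\psi)\to\operatorname{Schpec}(R,\phi)$ and vertical arrows $\beta:\mathcal U\to\operatorname{Schpec}$. 4. If $\theta$ is quasi-fibered and Cohen–Seidenberg, then $f^{-1}\operatorname{Schpec}(R,\phi)\subseteq\operatorname{Schpec}(S,\psi)$, and $\theta$ is fibered if and only if this is an equality. 5. The following are equivalent: (a) $\theta$ is fibered; (b) $\kappa_{\mathfrak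 q}(S,\psi)\cap R=\kappa_{\mathfrak q\cap R}(R,\phi)$ for all primes $\mathfrak q$ of $S$; (c) $\sqrt{\kappa_{\mathfrak a}(R,\phi)S}\subseteq\kappa_{\sqrt{\mathfrak aS}}(S,\psi)$ for all ideals $\mathfrak a$ of $R$. 6. If $\theta$ is fibered and Cohen–Seidenberg, then equality holds in 5(c) for all radical ideals $\mathfrak a$. 7. Suppose that $\phi$ is surjective and that either $\theta$ is Cohen–Seidenberg, or $R$ is a normal domain, $S$ is a domain and $\theta$ is finite and injective. Then the following are equivalent: $\theta$ is fibered; $h$ is continuous; $\beta$ takes values in the Schwede spectra on both sides and $f(\beta_{\mathfrak q}(S,\psi))=\beta_{f(\mathfrak q)}(R,\phi)$ for all primes $\mathfrak q$ of $S$; $\sqrt{\beta_{\mathfrak p}(R,\phi)S}=\beta_{\sqrt{\mathfrak pS}}(S,\psi)$ for all primes $\mathfrak p$ of $R$; $f^{-1}\{\beta_{\mathfrak p}(R,\phi)\}=\beta(S,\psi)(f^{-1}\{\mathfrak p\})$ for all primes $\mathfrak p$ of $R$; $\operatorname{Schpec}(S,\psi)=f^{-1}\operatorname{Schpec}(R,\phi)$.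 -/

import Mathlib

universe u v

/-- A ring `R` of characteristic `p` is `F`-finite if it is a finite module over itself through the
Frobenius `r ↦ r ^ p`. (Written out so that it also makes sense for the zero ring.) -/
def IsFFinite (p : ℕ) (R : Type u) [CommRing R] : Prop :=
  ∃ s : Finset R, ∀ x : R, ∃ c : R → R, x = ∑ i ∈ s, c i ^ p * i

/-- An element `φ` of `Hom_R(F^e_* R, R)`: an additive map `R → R` such that
`φ (r ^ (p ^ e) * x) = r * φ x`. A *Cartier pair* is a ring `R` with such a `φ`. -/
structure CartierMap (p e : ℕ) (R : Type u) [CommRing R] extends R →+ R where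
  map_pow_mul' : ∀ r x : R, toFun (r ^ p ^ e * x) = r * toFun x

namespace CartierMap

section

variable {p e : ℕ} {R : Type u} [CommRing R]

instance : CoeFun (CartierMap p e R) (fun _ => R → R) := ⟨fun φ => φ.toAddMonoidHom⟩

theorem map_pow_mul (φ : CartierMap p e R) (r x : R) : φ (r ^ p ^ e * x) = r * φ x :=
  φ.map_pow_mul' r x

/-- The `n`-th power `φ ^ n ∈ Hom_R(F^{en}_* R, R)`, i.e. the `n`-fold composite of `φ`. -/
def pow (φ : CartierMap p e R) (n : ℕ) : CartierMap p (e * n) R where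
  toFun := φ^[n]
  map_zero' := by
    induction n with
    | zero => rfl
    | succ n ih => rw [Function.iterate_succ_apply', ih]; exact map_zero φ.toAddMonoidHom
  map_add' x y := by
    induction n with
    | zero => rfl
    | succ n ih => simp only [Function.iterate_succ_apply', ih]; exact map_add φ.toAddMonoidHom _ _
  map_pow_mul' r x := by
    induction n generalizing r with
    | zero => simp
    | succ n ih =>
      have h : r ^ p ^ (e * (n + 1)) = (r ^ p ^ e) ^ p ^ (e * n) := by
        rw [← pow_mul, ← pow_add]; congr 2; ring
      simp only [Function.iterate_succ_apply', h] at ih ⊢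
      rw [ih (r ^ p ^ e), φ.map_pow_mul]

/-- The transpose `𝔞^φ = {x | φ(F^e_* xR) ⊆ 𝔞}` of an ideal `𝔞`. -/
def transpose (φ : CartierMap p e R) (a : Ideal R) : Ideal R where
  carrier := {x | ∀ r : R, φ (x * r) ∈ a}
  zero_mem' r := by
    rw [zero_mul, show φ (0 : R) = 0 from map_zero φ.toAddMonoidHom]; exact a.zero_mem
  add_mem' {x y} hx hy r := by
    rw [add_mul, show φ (x * r + y * r) = φ (x * r) + φ (y * r) from
      map_add φ.toAddMonoidHom _ _]
    exact a.add_mem (hx r) (hy r)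
  smul_mem' c x hx r := by
    have := hx (c * r)
    rwa [show x * (c * r) = c • x * r by rw [smul_eq_mul]; ring] at this

/-- `𝔞` is a `φ`-ideal: `φ(F^e_* 𝔞) ⊆ 𝔞`. -/
def IsPhiIdeal (φ : CartierMap p e R) (a : Ideal R) : Prop := ∀ x ∈ a, φ x ∈ a

/-- The Cartier core `κ_𝔞(R, φ) = ⋂_{n ≥ 1} 𝔞^{φ^n}`. -/
def kappa (φ : CartierMap p e R) (a : Ideal R) : Ideal R :=
  ⨅ (n : ℕ) (_ : 1 ≤ n), (φ.pow n).transpose a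

/-- `β_𝔞(R, φ) = 𝔞 ∩ κ_𝔞(R, φ)`. -/
def beta (φ : CartierMap p e R) (a : Ideal R) : Ideal R := a ⊓ φ.kappa a

theorem mem_beta (φ : CartierMap p e R) (a : Ideal R) (x : R) :
    x ∈ φ.beta a ↔ ∀ (n : ℕ) (r : R), φ^[n] (x * r) ∈ a := by
  simp only [beta, kappa, Submodule.mem_inf, Submodule.mem_iInf]
  constructor
  · rintro ⟨h0, h⟩ n r
    rcases Nat.eq_zero_or_pos n with rfl | hn
    · exact a.mul_mem_right r h0
    · exact h n hn r
  · intro h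
    exact ⟨by simpa using h 0 1, fun n _ r => h n r⟩

theorem isPhiIdeal_beta (φ : CartierMap p e R) (a : Ideal R) : φ.IsPhiIdeal (φ.beta a) := by
  intro x hx
  rw [mem_beta] at hx ⊢
  intro n r
  have := hx (n + 1) (r ^ p ^ e)
  rwa [Function.iterate_succ_apply, mul_comm, φ.map_pow_mul, mul_comm] at this

/-- For a prime ideal `𝔭` the ideal `β_𝔭` is prime. -/
theorem isPrime_beta (φ : CartierMap p e R) (a : Ideal R) [ha : a.IsPrime] :
    (φ.beta a).IsPrime := by
  refine ⟨fun h => ha.ne_top (top_le_iff.1 (h ▸ inf_le_left)), fun {x y} hxy => ?_⟩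
  by_contra! hcon
  obtain ⟨hx, hy⟩ := hcon
  have hx' : ∃ (n : ℕ) (r : R), φ^[n] (x * r) ∉ a := by
    by_contra! h; exact hx ((φ.mem_beta a x).2 h)
  have hy' : ∃ (m : ℕ) (s : R), φ^[m] (y * s) ∉ a := by
    by_contra! h; exact hy ((φ.mem_beta a y).2 h)
  obtain ⟨n, r, hz⟩ := hx'
  obtain ⟨m, s, hw⟩ := hy'
  have key : ∀ k : ℕ, ∀ t : R, t * y ∈ φ.beta a → φ^[k] t * y ∈ φ.beta a := by
    intro k
    induction k with
    | zero => intro t ht; exact ht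
    | succ k ih =>
      intro t ht
      rw [Function.iterate_succ_apply]
      refine ih _ ?_
      rcases Nat.eq_zero_or_pos (p ^ e) with h0 | h0
      · have h1 := φ.map_pow_mul 0 t
        rw [h0, pow_zero, one_mul, zero_mul] at h1
        rw [h1, zero_mul]; exact Ideal.zero_mem _
      · have h1 : t * y ^ p ^ e ∈ φ.beta a := by
          obtain ⟨c, hc⟩ := Nat.exists_eq_succ_of_ne_zero h0.ne'
          rw [hc, pow_succ', ← mul_assoc]
          exact Ideal.mul_mem_right _ _ ht
        have h2 := φ.isPhiIdeal_beta a _ h1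
        rwa [mul_comm, φ.map_pow_mul, mul_comm] at h2
  have hzy : φ^[n] (x * r) * y ∈ φ.beta a :=
    key n _ (by rw [mul_right_comm]; exact Ideal.mul_mem_right _ _ hxy)
  rcases ha.mem_or_mem ((φ.mem_beta a _).1 hzy 0 1 |> fun h => by simpa using h) with h | h
  · exact hz h
  set z := φ^[n] (x * r)
  have h3 : φ^[m] (z ^ p ^ (e * m) * (y * s)) ∈ a := by
    rcases Nat.eq_zero_or_pos (p ^ (e * m)) with h0 | h0
    · have h1 := (φ.pow m).map_pow_mul 0 (y * s)
      rw [h0, pow_zero, one_mul, zero_mul] at h1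
      exact absurd (show φ^[m] (y * s) ∈ a by
        rw [show φ^[m] (y * s) = 0 from h1]; exact a.zero_mem) hw
    · obtain ⟨c, hc⟩ := Nat.exists_eq_succ_of_ne_zero h0.ne'
      have := (φ.mem_beta a _).1 hzy m (z ^ c * s)
      rwa [show z * y * (z ^ c * s) = z ^ p ^ (e * m) * (y * s) by
        rw [hc, pow_succ']; ring] at this
  have h4 : φ^[m] (z ^ p ^ (e * m) * (y * s)) = z * φ^[m] (y * s) := (φ.pow m).map_pow_mul z _
  rw [h4] at h3
  exact (ha.mem_or_mem h3).elim hz hw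

/-- The Cartier spectrum: the set of prime `φ`-ideals, with the subspace topology of `Spec R`. -/
def CSpec (φ : CartierMap p e R) : Set (PrimeSpectrum R) := {x | φ.IsPhiIdeal x.asIdeal}

/-- The Schwede spectrum: the set of centers of `F`-purity, i.e. of the prime `φ`-ideals `𝔭` for
which the map `F^e_* κ(𝔭) → κ(𝔭)` on the residue field that is induced by `φ` is not zero. (Being
induced by `φ` determines it.) It has the subspace topology of `Spec R`. -/
def Schpec (φ : CartierMap p e R) : Set (PrimeSpectrum R) :=
  {x | x ∈ φ.CSpec ∧ ∃ g : CartierMap p e x.asIdeal.ResidueField,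
    (∀ r : R, g (algebraMap R x.asIdeal.ResidueField r) =
      algebraMap R x.asIdeal.ResidueField (φ r)) ∧ ∃ t, g t ≠ 0}

/-- The usual description of centers of `F`-purity: the prime `φ`-ideals `𝔭` with
`φ(F^e_* R) ⊄ 𝔭`. -/
theorem mem_Schpec_iff (φ : CartierMap p e R) (hp : 0 < p) (x : PrimeSpectrum R) :
    x ∈ φ.Schpec ↔ x ∈ φ.CSpec ∧ ∃ r : R, φ r ∉ x.asIdeal := by
  have hq : 0 < p ^ e := pow_pos hp e
  have hker : ∀ r : R, algebraMap R x.asIdeal.ResidueField r = 0 ↔ r ∈ x.asIdeal := fun r =>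
    Ideal.algebraMap_residueField_eq_zero
  have hfrac : ∀ t : x.asIdeal.ResidueField, ∃ a b : R, algebraMap R x.asIdeal.ResidueField b ≠ 0 ∧
      t * algebraMap R x.asIdeal.ResidueField b ^ p ^ e = algebraMap R x.asIdeal.ResidueField a := by
    intro t
    obtain ⟨a, b, hb, h⟩ := IsFractionRing.div_surjective (A := R ⧸ x.asIdeal) t
    obtain ⟨a, rfl⟩ := Ideal.Quotient.mk_surjective a
    obtain ⟨b, rfl⟩ := Ideal.Quotient.mk_surjective b
    have e1 : ∀ r : R, algebraMap (R ⧸ x.asIdeal) x.asIdeal.ResidueField (Ideal.Quotient.mk _ r) = algebraMap R x.asIdeal.ResidueField r :=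
      fun r => (IsScalarTower.algebraMap_apply R (R ⧸ x.asIdeal) x.asIdeal.ResidueField r).symm
    rw [e1, e1] at h
    have hb' : algebraMap R x.asIdeal.ResidueField b ≠ 0 := by
      rw [Ne, hker, ← Ideal.Quotient.eq_zero_iff_mem]
      exact nonZeroDivisors.ne_zero hb
    obtain ⟨c, hc⟩ := Nat.exists_eq_succ_of_ne_zero hq.ne'
    refine ⟨a * b ^ c, b, hb', ?_⟩
    rw [← h, hc, map_mul, map_pow, pow_succ]
    field_simp
  have hadd : ∀ a b : R, φ (a + b) = φ a + φ b := fun a b => map_add φ.toAddMonoidHom a b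
  have hsub : ∀ a b : R, φ (a - b) = φ a - φ b := fun a b => map_sub φ.toAddMonoidHom a b
  constructor
  · rintro ⟨hx, g, hg, t, ht⟩
    refine ⟨hx, ?_⟩
    by_contra! hcon
    obtain ⟨a, b, hb, h⟩ := hfrac t
    have h1 := g.map_pow_mul (algebraMap R x.asIdeal.ResidueField b) t
    rw [mul_comm, h, hg, (hker _).2 (hcon a)] at h1
    exact (mul_ne_zero hb ht) h1.symm
  · rintro ⟨hx, r, hr⟩
    refine ⟨hx, ?_⟩
    have huniq : ∀ (t : x.asIdeal.ResidueField) (a b a' b' : R), algebraMap R x.asIdeal.ResidueField b ≠ 0 → algebraMap R x.asIdeal.ResidueField b' ≠ 0 →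
        t * algebraMap R x.asIdeal.ResidueField b ^ p ^ e = algebraMap R x.asIdeal.ResidueField a →
        t * algebraMap R x.asIdeal.ResidueField b' ^ p ^ e = algebraMap R x.asIdeal.ResidueField a' →
        algebraMap R x.asIdeal.ResidueField (φ a) / algebraMap R x.asIdeal.ResidueField b = algebraMap R x.asIdeal.ResidueField (φ a') / algebraMap R x.asIdeal.ResidueField b' := by
      intro t a b a' b' hb hb' h h'
      have h0 : b' ^ p ^ e * a - b ^ p ^ e * a' ∈ x.asIdeal := by
        rw [← hker, map_sub, map_mul, map_mul, map_pow, map_pow, ← h, ← h']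
        ring
      have h1 := hx _ h0
      rw [hsub, φ.map_pow_mul, φ.map_pow_mul, ← hker, map_sub, map_mul, map_mul, sub_eq_zero] at h1
      rw [div_eq_div_iff hb hb']
      linear_combination h1
    choose A B hB hAB using hfrac
    let G : x.asIdeal.ResidueField → x.asIdeal.ResidueField := fun t => algebraMap R x.asIdeal.ResidueField (φ (A t)) / algebraMap R x.asIdeal.ResidueField (B t)
    have hG : ∀ (t : x.asIdeal.ResidueField) (a b : R), algebraMap R x.asIdeal.ResidueField b ≠ 0 →
        t * algebraMap R x.asIdeal.ResidueField b ^ p ^ e = algebraMap R x.asIdeal.ResidueField a →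
        G t = algebraMap R x.asIdeal.ResidueField (φ a) / algebraMap R x.asIdeal.ResidueField b := fun t a b hb h =>
      huniq t _ _ a b (hB t) hb (hAB t) h
    have hGalg : ∀ r : R, G (algebraMap R x.asIdeal.ResidueField r) = algebraMap R x.asIdeal.ResidueField (φ r) := by
      intro r
      rw [hG _ r 1 (by simp) (by simp)]; simp
    let g : CartierMap p e x.asIdeal.ResidueField :=
      { toFun := G
        map_zero' := by
          have := hGalg 0
          rwa [map_zero, show φ (0 : R) = 0 from map_zero φ.toAddMonoidHom, map_zero] at this
        map_add' := by
          intro s t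
          rw [hG (s + t) (B t ^ p ^ e * A s + B s ^ p ^ e * A t) (B s * B t)
            (by rw [map_mul]; exact mul_ne_zero (hB s) (hB t))
            (by simp only [map_add, map_mul, map_pow, ← hAB]; ring)]
          rw [hadd, φ.map_pow_mul, φ.map_pow_mul]
          have h1 := hB s
          have h2 := hB t
          simp only [G, map_add, map_mul]
          field_simp
        map_pow_mul' := by
          intro s t
          obtain ⟨c, d, hd, hcd⟩ : ∃ c d : R, algebraMap R x.asIdeal.ResidueField d ≠ 0 ∧
              s * algebraMap R x.asIdeal.ResidueField d = algebraMap R x.asIdeal.ResidueField c := by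
            refine ⟨A s, B s ^ p ^ e, by rw [map_pow]; exact pow_ne_zero _ (hB s), ?_⟩
            rw [map_pow, hAB]
          change G _ = s * G t
          rw [hG (s ^ p ^ e * t) (c ^ p ^ e * A t) (d * B t)
            (by rw [map_mul]; exact mul_ne_zero hd (hB t))
            (by simp only [map_mul, map_pow, ← hAB, ← hcd]; ring)]
          rw [φ.map_pow_mul]
          have h2 := hB t
          simp only [G, map_mul, ← hcd]
          field_simp }
    exact ⟨g, hGalg, algebraMap R x.asIdeal.ResidueField r, by
      change G _ ≠ 0
      rw [hGalg, Ne, hker]; exact hr⟩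

/-- The Cartier–Zariski topology on `Spec R`: its closed sets are the `V(𝔞)` with `𝔞` a
`φ`-ideal. -/
abbrev czTopology (φ : CartierMap p e R) : TopologicalSpace (PrimeSpectrum R) :=
  TopologicalSpace.ofClosed
    {Z | ∃ a : Ideal R, φ.IsPhiIdeal a ∧ Z = PrimeSpectrum.zeroLocus (a : Set R)}
    ⟨⊤, fun _ _ => trivial, by simp⟩
    (by
      intro A hA
      refine ⟨sSup {a | φ.IsPhiIdeal a ∧ PrimeSpectrum.zeroLocus (a : Set R) ∈ A}, ?_, ?_⟩
      · intro x hx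
        rw [sSup_eq_iSup'] at hx ⊢
        refine Submodule.iSup_induction _ (motive := fun y => φ y ∈ _) hx ?_ ?_ ?_
        · intro i y hy
          exact Submodule.mem_iSup_of_mem i (i.2.1 y hy)
        · rw [show φ (0 : R) = 0 from map_zero φ.toAddMonoidHom]; exact Ideal.zero_mem _
        · intro y z hy hz
          rw [show φ (y + z) = φ y + φ z from map_add φ.toAddMonoidHom _ _]
          exact Ideal.add_mem _ hy hz
      · ext x
        rw [Set.mem_sInter, PrimeSpectrum.mem_zeroLocus, SetLike.coe_subset_coe, sSup_le_iff]
        constructor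
        · rintro h a ⟨_, ha⟩
          exact h _ ha
        · intro h Z hZ
          obtain ⟨a, ha, rfl⟩ := hA hZ
          exact h a ⟨ha, hZ⟩)
    (by
      rintro _ ⟨a, ha, rfl⟩ _ ⟨b, hb, rfl⟩
      exact ⟨a ⊓ b, fun x hx => ⟨ha x hx.1, hb x hx.2⟩,
        (PrimeSpectrum.zeroLocus_inf a b).symm⟩)

/-- `CZpec(R, φ)`: the set `Spec R` with the Cartier–Zariski topology. -/
def CZpec (_φ : CartierMap p e R) : Type u := PrimeSpectrum R

instance (φ : CartierMap p e R) : TopologicalSpace φ.CZpec := φ.czTopology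

/-- The Cartier core map (retraction) `β : CZpec(R, φ) → CSpec(R, φ)`, `𝔭 ↦ β_𝔭(R, φ)`. -/
def coreMap (φ : CartierMap p e R) (x : φ.CZpec) : φ.CSpec :=
  ⟨⟨φ.beta (PrimeSpectrum.asIdeal x),
    haveI := PrimeSpectrum.isPrime x; φ.isPrime_beta (PrimeSpectrum.asIdeal x)⟩,
    φ.isPhiIdeal_beta (PrimeSpectrum.asIdeal x)⟩

/-- The `F`-pure locus `U(R, φ) = {𝔭 | κ_𝔭(R, φ) ≠ R}`, a subspace of `CZpec(R, φ)`. -/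
def FPureLocus (φ : CartierMap p e R) : Set φ.CZpec :=
  {x | φ.kappa (PrimeSpectrum.asIdeal x) ≠ ⊤}

end

end CartierMap

/-- A homomorphism of Cartier pairs `θ : (R, φ) → (S, ψ)`: a ring homomorphism with
`θ ∘ φ = ψ ∘ F^e_* θ`. -/
structure CartierHom {p e : ℕ} {R : Type u} {S : Type v} [CommRing R] [CommRing S]
    (φ : CartierMap p e R) (ψ : CartierMap p e S) where
  toRingHom : R →+* S
  comm : ∀ x : R, toRingHom (φ x) = ψ (toRingHom x)

/-- A ring homomorphism is Cohen–Seidenberg if it satisfies incomparability, going-up and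
going-down. -/
structure IsCohenSeidenberg {R : Type u} {S : Type v} [CommRing R] [CommRing S]
    (θ : R →+* S) : Prop where
  incomparability : ∀ q q' : PrimeSpectrum S, q ≤ q' →
    PrimeSpectrum.comap θ q = PrimeSpectrum.comap θ q' → q = q'
  goingUp : @Algebra.HasGoingUp R S _ _ θ.toAlgebra
  goingDown : @Algebra.HasGoingDown R S _ _ θ.toAlgebra

namespace CartierHom

section

variable {p e : ℕ} {R : Type u} {S : Type v} [CommRing R] [CommRing S]
  {φ : CartierMap p e R} {ψ : CartierMap p e S}

/-- `f = Spec θ : Spec S → Spec R`, `𝔮 ↦ 𝔮 ∩ R`. -/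
def specMap (θ : CartierHom φ ψ) : PrimeSpectrum S → PrimeSpectrum R :=
  PrimeSpectrum.comap θ.toRingHom

/-- `h = CZpec θ : CZpec(S, ψ) → CZpec(R, φ)`, `𝔮 ↦ 𝔮 ∩ R`. -/
def czMap (θ : CartierHom φ ψ) : ψ.CZpec → φ.CZpec := θ.specMap

/-- `g = CSpec θ : CSpec(S, ψ) → CSpec(R, φ)`, `𝔮 ↦ 𝔮 ∩ R`. -/
def cMap (θ : CartierHom φ ψ) (y : ψ.CSpec) : φ.CSpec :=
  ⟨θ.specMap y.1, fun x hx => by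
    change θ.toRingHom (φ x) ∈ y.1.asIdeal
    rw [θ.comm]
    exact y.2 _ hx⟩

/-- `θ` is quasi-fibered: `CZpec θ` is continuous. -/
def IsQuasiFibered (θ : CartierHom φ ψ) : Prop := Continuous θ.czMap

/-- `θ` is fibered: it is quasi-fibered and the `F`-pure locus of `(S, ψ)` is the preimage of the
`F`-pure locus of `(R, φ)`. -/
def IsFibered (θ : CartierHom φ ψ) : Prop :=
  θ.IsQuasiFibered ∧ θ.czMap ⁻¹' φ.FPureLocus = ψ.FPureLocus

/-- There is a commutative square of topological spaces and continuous maps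

`U(S, ψ) → U(R, φ)`, `Schpec(S, ψ) → Schpec(R, φ)` (contraction of primes, horizontally) and
`U(S, ψ) → Schpec(S, ψ)`, `U(R, φ) → Schpec(R, φ)` (the retractions `β`, vertically). -/
def HasSchwedeSquare (θ : CartierHom φ ψ) : Prop :=
  ∃ (hU : Set.MapsTo θ.czMap ψ.FPureLocus φ.FPureLocus)
    (hS : Set.MapsTo θ.specMap ψ.Schpec φ.Schpec)
    (bS : Set.MapsTo (fun y => (ψ.coreMap y : PrimeSpectrum S)) ψ.FPureLocus ψ.Schpec)
    (bR : Set.MapsTo (fun x => (φ.coreMap x : PrimeSpectrum R)) φ.FPureLocus φ.Schpec),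
    Continuous hU.restrict ∧ Continuous hS.restrict ∧
    Continuous bS.restrict ∧ Continuous bR.restrict ∧
    hS.restrict ∘ bS.restrict = bR.restrict ∘ hU.restrict

end

end CartierHom

/-! `β_𝔟` is the largest `φ`-ideal inside `𝔟`, and `κ_𝔟` is its transpose `(β_𝔟)^φ`. For a prime `𝔭`
the ideal `β_𝔭` is prime, and `κ_𝔭` is either `R` or `β_𝔭`; the first case occurs exactly when `φ(R)
⊆ β_𝔭`, that is, when `β_𝔭` is not in `Schpec`.

One inclusion between `β_𝔮 ∩ R` and `β_{𝔮 ∩ R}` is automatic. The other is continuity of `h`, tested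
on the closed set `V(β_{𝔮 ∩ R})` (`isQuasiFibered_iff_commutesWithBeta`). Since `β` and `κ` commute
with intersections, statements about radicals reduce to primes. Under Cohen–Seidenberg hypotheses,
primes over `β_𝔭` are exactly the `β_𝔮` with `𝔮` over `𝔭` (`CommutesWithBeta.exists_coreMap_eq`),
which turns inclusions into equalities. The dichotomy for `κ_𝔭` transfers the results from `β` to
`κ`; for surjective `φ` every prime is in the `F`-pure locus and the two theories coincide. -/

namespace CartierMap

section

variable {p e : ℕ} {R : Type u} [CommRing R] (φ : CartierMap p e R)

/-! ### Formal properties of `β` and `κ` on one Cartier pair. -/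

theorem mem_kappa (a : Ideal R) (x : R) :
    x ∈ φ.kappa a ↔ ∀ n : ℕ, 1 ≤ n → ∀ r : R, φ^[n] (x * r) ∈ a := by
  simp only [kappa, Submodule.mem_iInf]
  rfl

/-- Split off one `φ` from `φ^(n+1)`: a multiplier `s` applied after it is absorbed before it as `s
^ p ^ e`. This makes `κ` the transpose of `β`. -/
theorem mem_kappa_iff_beta (a : Ideal R) (x : R) :
    x ∈ φ.kappa a ↔ ∀ r : R, φ (x * r) ∈ φ.beta a := by
  rw [mem_kappa]
  constructor
  · intro h r
    rw [mem_beta]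
    intro n s
    have := h (n + 1) (by omega) (r * s ^ p ^ e)
    rwa [Function.iterate_succ_apply, ← mul_assoc, mul_comm (x * r), φ.map_pow_mul, mul_comm] at this
  · intro h n hn r
    obtain ⟨m, rfl⟩ := Nat.exists_eq_succ_of_ne_zero (show n ≠ 0 by omega)
    have := (φ.mem_beta a _).1 (h r) m 1
    rwa [mul_one, ← Function.iterate_succ_apply] at this

theorem beta_le (a : Ideal R) : φ.beta a ≤ a := inf_le_left

theorem beta_le_kappa (a : Ideal R) : φ.beta a ≤ φ.kappa a := inf_le_right

theorem beta_mono {a b : Ideal R} (h : a ≤ b) : φ.beta a ≤ φ.beta b := fun x hx =>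
  (φ.mem_beta b x).2 fun n r => h ((φ.mem_beta a x).1 hx n r)

theorem kappa_mono {a b : Ideal R} (h : a ≤ b) : φ.kappa a ≤ φ.kappa b := fun x hx =>
  (φ.mem_kappa b x).2 fun n hn r => h ((φ.mem_kappa a x).1 hx n hn r)

-- Together with `beta_le` and `isPhiIdeal_beta`, this characterizes `β_𝔟` as the largest `φ`-ideal
-- in `𝔟`.
variable {φ} in
theorem IsPhiIdeal.le_beta {a b : Ideal R} (ha : φ.IsPhiIdeal a) (h : a ≤ b) :
    a ≤ φ.beta b := by
  intro x hx
  rw [mem_beta]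
  intro n r
  refine h ?_
  have hxr : x * r ∈ a := a.mul_mem_right r hx
  generalize x * r = y at hxr
  induction n generalizing y with
  | zero => exact hxr
  | succ n ih => exact ih _ (ha y hxr)

variable {φ} in
theorem IsPhiIdeal.beta_eq {a : Ideal R} (ha : φ.IsPhiIdeal a) : φ.beta a = a :=
  le_antisymm (φ.beta_le a) (ha.le_beta le_rfl)

theorem beta_sInf (s : Set (Ideal R)) : φ.beta (sInf s) = ⨅ a ∈ s, φ.beta a := by
  ext x
  simp only [mem_beta, Submodule.mem_iInf, Submodule.mem_sInf]
  exact ⟨fun h a ha n r => h n r a ha, fun h n r a ha => h a ha n r⟩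

theorem kappa_sInf (s : Set (Ideal R)) : φ.kappa (sInf s) = ⨅ a ∈ s, φ.kappa a := by
  ext x
  simp only [mem_kappa, Submodule.mem_iInf, Submodule.mem_sInf]
  exact ⟨fun h a ha n hn r => h n hn r a ha, fun h n hn r a ha => h a ha n hn r⟩

/-! ### Reduction from radical ideals to primes. -/

theorem le_beta_radical_iff (a b : Ideal R) :
    b ≤ φ.beta a.radical ↔ ∀ x : PrimeSpectrum R, a ≤ x.asIdeal → b ≤ φ.beta x.asIdeal := by
  rw [Ideal.radical_eq_sInf, beta_sInf, le_iInf₂_iff]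
  exact ⟨fun h x hx => h _ ⟨hx, x.isPrime⟩, fun h P hP => h ⟨P, hP.2⟩ hP.1⟩

theorem le_kappa_radical_iff (a b : Ideal R) :
    b ≤ φ.kappa a.radical ↔ ∀ x : PrimeSpectrum R, a ≤ x.asIdeal → b ≤ φ.kappa x.asIdeal := by
  rw [Ideal.radical_eq_sInf, kappa_sInf, le_iInf₂_iff]
  exact ⟨fun h x hx => h _ ⟨hx, x.isPrime⟩, fun h P hP => h ⟨P, hP.2⟩ hP.1⟩

/-- A prime containing `β_𝔞`, `𝔞` radical, contains `β_𝔭` for some prime `𝔭` containing `𝔞`. -/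
theorem exists_beta_le_of_beta_le [IsNoetherianRing R] {a : Ideal R} (ha : a.IsRadical)
    {Q : Ideal R} (hQ : Q.IsPrime) (h : φ.beta a ≤ Q) :
    ∃ x : PrimeSpectrum R, a ≤ x.asIdeal ∧ φ.beta x.asIdeal ≤ Q := by
  have hfin := a.finite_minimalPrimes_of_isNoetherianRing R
  rw [← ha.radical, ← Ideal.sInf_minimalPrimes, beta_sInf] at h
  -- There are finitely many minimal primes, and a prime containing a finite intersection contains
  -- one of the terms.
  obtain ⟨P, hP, hPQ⟩ := (Ideal.IsPrime.inf_le' (s := hfin.toFinset) (f := φ.beta) hQ).1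
    (by simpa [Finset.inf_eq_iInf] using h)
  rw [Set.Finite.mem_toFinset] at hP
  exact ⟨⟨P, hP.1.1⟩, hP.1.2, hPQ⟩

theorem exists_kappa_le_of_kappa_le [IsNoetherianRing R] {a : Ideal R} (ha : a.IsRadical)
    {Q : Ideal R} (hQ : Q.IsPrime) (h : φ.kappa a ≤ Q) :
    ∃ x : PrimeSpectrum R, a ≤ x.asIdeal ∧ φ.kappa x.asIdeal ≤ Q := by
  have hfin := a.finite_minimalPrimes_of_isNoetherianRing R
  rw [← ha.radical, ← Ideal.sInf_minimalPrimes, kappa_sInf] at h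
  obtain ⟨P, hP, hPQ⟩ := (Ideal.IsPrime.inf_le' (s := hfin.toFinset) (f := φ.kappa) hQ).1
    (by simpa [Finset.inf_eq_iInf] using h)
  rw [Set.Finite.mem_toFinset] at hP
  exact ⟨⟨P, hP.1.1⟩, hP.1.2, hPQ⟩

/-! ### The `F`-pure locus, the Schwede spectrum and the Cartier–Zariski topology. -/

theorem kappa_eq_top_iff (a : Ideal R) : φ.kappa a = ⊤ ↔ ∀ r, φ r ∈ φ.beta a := by
  rw [Ideal.eq_top_iff_one, mem_kappa_iff_beta]
  simp

/-- The Cartier core `κ_𝔭` of a prime `𝔭` is either the unit ideal or the prime `β_𝔭`. -/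
theorem kappa_eq_beta_of_ne_top (hp : 0 < p) (a : Ideal R) [a.IsPrime] (h : φ.kappa a ≠ ⊤) :
    φ.kappa a = φ.beta a := by
  refine le_antisymm (fun x hx => ?_) (φ.beta_le_kappa a)
  by_contra hxb
  refine h ((φ.kappa_eq_top_iff a).2 fun r => ?_)
  obtain ⟨c, hc⟩ := Nat.exists_eq_succ_of_ne_zero (pow_pos hp e).ne'
  -- As `p ^ e = c + 1`, this multiplier gives `φ (x ^ p ^ e * r) = x * φ r` in the prime `β`, while
  -- `x` is not in it.
  have := (φ.mem_kappa_iff_beta a x).1 hx (x ^ c * r)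
  rw [← mul_assoc, ← pow_succ', ← Nat.succ_eq_add_one, ← hc, φ.map_pow_mul] at this
  exact ((φ.isPrime_beta a).mem_or_mem this).resolve_left hxb

theorem isRadical_kappa (hp : 0 < p) (a : Ideal R) [a.IsPrime] : (φ.kappa a).IsRadical := by
  by_cases h : φ.kappa a = ⊤
  · rw [h]; exact fun _ _ => trivial
  · rw [φ.kappa_eq_beta_of_ne_top hp a h]; exact (φ.isPrime_beta a).isRadical

/-- Both sides say that `φ(R)` is not contained in `β_𝔭`. -/
theorem coreMap_mem_Schpec_iff (hp : 0 < p) (x : φ.CZpec) :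
    (φ.coreMap x : PrimeSpectrum R) ∈ φ.Schpec ↔ x ∈ φ.FPureLocus := by
  rw [φ.mem_Schpec_iff hp]
  change _ ↔ φ.kappa (PrimeSpectrum.asIdeal x) ≠ ⊤
  rw [Ne, kappa_eq_top_iff, not_forall]
  exact and_iff_right (φ.coreMap x).2

theorem coreMap_of_mem_CSpec (x : PrimeSpectrum R) (hx : x ∈ φ.CSpec) :
    (φ.coreMap x : PrimeSpectrum R) = x :=
  PrimeSpectrum.ext (IsPhiIdeal.beta_eq hx)

theorem isClosed_czpec_iff (Z : Set φ.CZpec) :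
    IsClosed Z ↔ ∃ a : Ideal R, φ.IsPhiIdeal a ∧ Z = PrimeSpectrum.zeroLocus (a : Set R) := by
  rw [← isOpen_compl_iff]
  change Zᶜᶜ ∈ {Z | ∃ a : Ideal R, φ.IsPhiIdeal a ∧ Z = PrimeSpectrum.zeroLocus (a : Set R)} ↔ _
  rw [compl_compl]
  rfl

/-- The preimage of `V(𝔞)` is `V` of the smallest `φ`-ideal containing `𝔞`, by the maximality of
`β`. -/
theorem continuous_coreMap : Continuous fun x => (φ.coreMap x : PrimeSpectrum R) := by
  rw [continuous_iff_isClosed]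
  intro Z hZ
  obtain ⟨a, rfl⟩ := (PrimeSpectrum.isClosed_iff_zeroLocus_ideal Z).1 hZ
  rw [isClosed_czpec_iff]
  refine ⟨sInf {b | φ.IsPhiIdeal b ∧ a ≤ b}, fun x hx => ?_, ?_⟩
  · rw [Submodule.mem_sInf] at hx ⊢
    exact fun b hb => hb.1 _ (hx b hb)
  · ext x
    change a ≤ φ.beta (PrimeSpectrum.asIdeal x) ↔
      sInf {b | φ.IsPhiIdeal b ∧ a ≤ b} ≤ PrimeSpectrum.asIdeal x
    refine ⟨fun h => le_trans (sInf_le ⟨φ.isPhiIdeal_beta _, h⟩) (φ.beta_le _), fun h => ?_⟩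
    refine le_trans (le_sInf fun b hb => hb.2) (IsPhiIdeal.le_beta (fun x hx => ?_) h)
    rw [Submodule.mem_sInf] at hx ⊢
    exact fun b hb => hb.1 _ (hx b hb)

theorem kappa_ne_top_of_surjective (hφ : Function.Surjective φ) {a : Ideal R} (ha : a ≠ ⊤) :
    φ.kappa a ≠ ⊤ := by
  rw [Ne, kappa_eq_top_iff]
  intro h
  obtain ⟨r, hr⟩ := hφ 1
  exact ha ((Ideal.eq_top_iff_one a).2 (φ.beta_le a (hr ▸ h r)))

end

end CartierMap

/-! ### Lifting primes along Cohen–Seidenberg homomorphisms. -/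

namespace IsCohenSeidenberg

variable {R : Type u} {S : Type v} [CommRing R] [CommRing S] {f : R →+* S}

theorem exists_le_comap_eq (hf : IsCohenSeidenberg f) (y : PrimeSpectrum S) (x : PrimeSpectrum R)
    (h : x ≤ PrimeSpectrum.comap f y) : ∃ z ≤ y, PrimeSpectrum.comap f z = x := by
  let := f.toAlgebra
  have := hf.goingDown
  obtain ⟨P, hP, hP', hl⟩ := Ideal.exists_ideal_le_liesOver_of_le (p := x.asIdeal)
    (q := y.asIdeal.under R) y.asIdeal h
  exact ⟨⟨P, hP'⟩, hP, PrimeSpectrum.ext hl.over.symm⟩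

theorem exists_ge_comap_eq (hf : IsCohenSeidenberg f) (y : PrimeSpectrum S) (x : PrimeSpectrum R)
    (h : PrimeSpectrum.comap f y ≤ x) : ∃ z, y ≤ z ∧ PrimeSpectrum.comap f z = x := by
  let := f.toAlgebra
  have := hf.goingUp
  obtain ⟨P, hP, hP', hl⟩ := Ideal.exists_ideal_ge_liesOver_of_le (q := x.asIdeal)
    (p := y.asIdeal.under R) y.asIdeal h
  exact ⟨⟨P, hP'⟩, hP, PrimeSpectrum.ext hl.over.symm⟩

theorem of_finite [IsDomain R] [IsIntegrallyClosed R] [IsDomain S]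
    (hinj : Function.Injective f) (hfin : f.Finite) : IsCohenSeidenberg f := by
  let := f.toAlgebra
  have : Module.Finite R S := hfin
  have : Algebra.IsIntegral R S := inferInstance
  have : FaithfulSMul R S := (faithfulSMul_iff_algebraMap_injective R S).2 hinj
  refine ⟨fun q q' hle h => ?_, inferInstance, inferInstance⟩
  rcases hle.eq_or_lt with h' | h'
  · exact h'
  · exact absurd (congrArg PrimeSpectrum.asIdeal h)
      (Ideal.IsIntegral.comap_lt_comap (R := R) (I := q.asIdeal) (J := q'.asIdeal) h').ne

end IsCohenSeidenberg

/-! ### Inclusions valid for every homomorphism of Cartier pairs. -/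

namespace CartierHom

section

variable {p e : ℕ} {R : Type u} {S : Type v} [CommRing R] [CommRing S]
  {φ : CartierMap p e R} {ψ : CartierMap p e S} (θ : CartierHom φ ψ)

theorem map_iterate (n : ℕ) (x : R) : θ.toRingHom (φ^[n] x) = ψ^[n] (θ.toRingHom x) :=
  Function.Semiconj.iterate_right θ.comm n x

/-- The left side tests all multiples by elements of `S`, the right side only those by elements of
`R`. -/
theorem comap_beta_le (q : Ideal S) :
    (ψ.beta q).comap θ.toRingHom ≤ φ.beta (q.comap θ.toRingHom) := by
  intro x hx
  rw [CartierMap.mem_beta]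
  intro n r
  rw [Ideal.mem_comap, map_iterate, map_mul]
  exact (ψ.mem_beta _ _).1 hx n _

theorem comap_kappa_le (q : Ideal S) :
    (ψ.kappa q).comap θ.toRingHom ≤ φ.kappa (q.comap θ.toRingHom) := by
  intro x hx
  rw [CartierMap.mem_kappa]
  intro n hn r
  rw [Ideal.mem_comap, map_iterate, map_mul]
  exact (ψ.mem_kappa _ _).1 hx n hn _

theorem CSpec_subset : ψ.CSpec ⊆ θ.specMap ⁻¹' φ.CSpec := fun y hy => (θ.cMap ⟨y, hy⟩).2

theorem preimage_FPureLocus_subset : θ.czMap ⁻¹' φ.FPureLocus ⊆ ψ.FPureLocus := by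
  intro y hy h
  refine hy (top_le_iff.1 (le_trans ?_ (θ.comap_kappa_le (PrimeSpectrum.asIdeal y))))
  rw [h, Ideal.comap_top]

theorem mem_Schpec_of_specMap_mem (hp : 0 < p) {y : PrimeSpectrum S} (hy : y ∈ ψ.CSpec)
    (h : θ.specMap y ∈ φ.Schpec) : y ∈ ψ.Schpec := by
  obtain ⟨-, r, hr⟩ := (φ.mem_Schpec_iff hp _).1 h
  exact (ψ.mem_Schpec_iff hp _).2 ⟨hy, θ.toRingHom r, fun h => hr (by
    change θ.toRingHom (φ r) ∈ y.asIdeal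
    rwa [θ.comm])⟩

/-! ### Quasi-fibered homomorphisms. -/

/-- `θ` commutes with the Cartier core maps `𝔭 ↦ β_𝔭`. -/
def CommutesWithBeta : Prop :=
  ∀ q : PrimeSpectrum S, (ψ.beta q.asIdeal).comap θ.toRingHom =
    φ.beta (q.asIdeal.comap θ.toRingHom)

/-- `θ` commutes with the formation of the Cartier cores `κ_𝔭`. -/
def CommutesWithKappa : Prop :=
  ∀ q : PrimeSpectrum S, (ψ.kappa q.asIdeal).comap θ.toRingHom =
    φ.kappa (q.asIdeal.comap θ.toRingHom)

theorem commutesWithBeta_iff_cMap_comp :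
    θ.CommutesWithBeta ↔ θ.cMap ∘ ψ.coreMap = φ.coreMap ∘ θ.czMap := by
  constructor
  · intro h
    funext y
    exact Subtype.ext (PrimeSpectrum.ext (h y))
  · intro h q
    exact congrArg (fun x : φ.CSpec => x.1.asIdeal) (congrFun h q)

/-- If the preimage of `V(β_{𝔮 ∩ R})` is `V(𝔟)` with `𝔟` a `ψ`-ideal, then `𝔟 ⊆ 𝔮` forces `𝔟 ⊆ β_𝔮`,
so `β_𝔮` lies in that preimage too. Conversely, the preimage of `V(𝔞)` is `V(√(𝔞S))`, and this
radical is a `ψ`-ideal because it lies in its own `β`. -/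
theorem isQuasiFibered_iff_commutesWithBeta : θ.IsQuasiFibered ↔ θ.CommutesWithBeta := by
  rw [IsQuasiFibered, continuous_iff_isClosed]
  constructor
  · intro h q
    refine le_antisymm (θ.comap_beta_le _) ?_
    obtain ⟨b, hb, hZ⟩ := (ψ.isClosed_czpec_iff _).1 (h _ ((φ.isClosed_czpec_iff _).2
      ⟨φ.beta (q.asIdeal.comap θ.toRingHom), φ.isPhiIdeal_beta _, rfl⟩))
    have hq : q ∈ PrimeSpectrum.zeroLocus (b : Set S) := by
      rw [← hZ]
      exact φ.beta_le (q.asIdeal.comap θ.toRingHom)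
    have hβ : (ψ.coreMap q : PrimeSpectrum S) ∈ PrimeSpectrum.zeroLocus (b : Set S) :=
      hb.le_beta hq
    rw [← hZ] at hβ
    exact hβ
  · intro h Z hZ
    obtain ⟨a, ha, rfl⟩ := (φ.isClosed_czpec_iff _).1 hZ
    refine (ψ.isClosed_czpec_iff _).2 ⟨(a.map θ.toRingHom).radical, ?_, ?_⟩
    · have : (a.map θ.toRingHom).radical ≤ ψ.beta (a.map θ.toRingHom).radical := by
        rw [CartierMap.le_beta_radical_iff]
        intro y hy
        have := ψ.isPrime_beta y.asIdeal
        refine this.radical_le_iff.2 ?_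
        rw [Ideal.map_le_iff_le_comap] at hy ⊢
        rw [h y]
        exact ha.le_beta hy
      exact fun x hx => ψ.beta_le _ (ψ.isPhiIdeal_beta _ _ (this hx))
    · ext y
      change a ≤ (PrimeSpectrum.asIdeal y).comap θ.toRingHom ↔ _ ≤ PrimeSpectrum.asIdeal y
      rw [(PrimeSpectrum.isPrime y).radical_le_iff, Ideal.map_le_iff_le_comap]

variable {θ}

theorem CommutesWithBeta.radical_map_beta_le (h : θ.CommutesWithBeta) (a : Ideal R) :
    ((φ.beta a).map θ.toRingHom).radical ≤ ψ.beta (a.map θ.toRingHom).radical := by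
  rw [CartierMap.le_beta_radical_iff]
  intro y hy
  have := ψ.isPrime_beta y.asIdeal
  refine this.radical_le_iff.2 ?_
  rw [Ideal.map_le_iff_le_comap] at hy ⊢
  rw [h y]
  exact φ.beta_mono hy

-- Only the prime `𝔭 = 𝔮 ∩ R` is needed: `𝔮` contains `√(𝔭S)`, so `β_𝔮` contains `β` of that
-- radical.
variable (θ) in
theorem commutesWithBeta_of_radical_map_beta_le
    (h : ∀ x : PrimeSpectrum R, ((φ.beta x.asIdeal).map θ.toRingHom).radical ≤
      ψ.beta (x.asIdeal.map θ.toRingHom).radical) : θ.CommutesWithBeta := by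
  intro q
  refine le_antisymm (θ.comap_beta_le _) ?_
  rw [← Ideal.map_le_iff_le_comap]
  exact Ideal.le_radical.trans ((ψ.le_beta_radical_iff _ _).1 (h (θ.specMap q)) q
    Ideal.map_comap_le)

variable (θ) in
theorem isQuasiFibered_tfae :
    [θ.IsQuasiFibered,
      θ.cMap ∘ ψ.coreMap = φ.coreMap ∘ θ.czMap,
      ∀ q : PrimeSpectrum S, (ψ.beta q.asIdeal).comap θ.toRingHom =
        φ.beta (q.asIdeal.comap θ.toRingHom),
      ∀ a : Ideal R, ((φ.beta a).map θ.toRingHom).radical ≤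
        ψ.beta (a.map θ.toRingHom).radical,
      ∀ x : PrimeSpectrum R, ((φ.beta x.asIdeal).map θ.toRingHom).radical ≤
        ψ.beta (x.asIdeal.map θ.toRingHom).radical].TFAE := by
  tfae_have 1 ↔ 3 := θ.isQuasiFibered_iff_commutesWithBeta
  tfae_have 3 ↔ 2 := θ.commutesWithBeta_iff_cMap_comp
  tfae_have 3 → 4 := CommutesWithBeta.radical_map_beta_le
  tfae_have 4 → 5 := fun h x => h x.asIdeal
  tfae_have 5 → 3 := θ.commutesWithBeta_of_radical_map_beta_le
  tfae_finish

theorem CommutesWithBeta.coreMap_comm (h : θ.CommutesWithBeta) (y : ψ.CZpec) :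
    θ.specMap (ψ.coreMap y) = φ.coreMap (θ.czMap y) :=
  PrimeSpectrum.ext (h y)

/-! ### Quasi-fibered homomorphisms that are Cohen–Seidenberg. -/

theorem CommutesWithBeta.CSpec_eq (h : θ.CommutesWithBeta)
    (hθ : IsCohenSeidenberg θ.toRingHom) : ψ.CSpec = θ.specMap ⁻¹' φ.CSpec := by
  refine θ.CSpec_subset.antisymm fun y hy => ?_
  -- `β_y ⊆ y` have the same contraction, as the contraction of `y` is fixed by `β`; incomparability
  -- applies.
  have h1 : (ψ.coreMap y : PrimeSpectrum S) = y :=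
    hθ.incomparability _ _ (ψ.beta_le y.asIdeal)
      ((h.coreMap_comm y).trans (φ.coreMap_of_mem_CSpec _ hy))
  rw [← h1]
  exact (ψ.coreMap y).2

/-- A prime over `β_𝔭` is `β_𝔮` for some `𝔮` over `𝔭`. -/
theorem CommutesWithBeta.exists_coreMap_eq (h : θ.CommutesWithBeta)
    (hθ : IsCohenSeidenberg θ.toRingHom) (x : φ.CZpec) (y : PrimeSpectrum S)
    (hy : θ.specMap y = φ.coreMap x) :
    ∃ z : ψ.CZpec, θ.czMap z = x ∧ (ψ.coreMap z : PrimeSpectrum S) = y := by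
  obtain ⟨z, hyz, hz⟩ := hθ.exists_ge_comap_eq y x
    (hy.trans_le (φ.beta_le (PrimeSpectrum.asIdeal x)))
  have hyC : y ∈ ψ.CSpec := by
    rw [h.CSpec_eq hθ, Set.mem_preimage, hy]
    exact (φ.coreMap x).2
  -- The lift `z` comes from going-up. Since `y` is a `ψ`-ideal in `z`, it lies in `β_z`, and both
  -- contract to `β_x`.
  refine ⟨z, hz, (hθ.incomparability y (ψ.coreMap z)
    (CartierMap.IsPhiIdeal.le_beta hyC hyz) ?_).symm⟩
  refine hy.trans (Eq.trans ?_ (h.coreMap_comm z).symm)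
  rw [show θ.czMap z = x from hz]

/-- A prime whose contraction contains `β_𝔭` contains `β_𝔮` for some `𝔮` over `𝔭`. -/
theorem CommutesWithBeta.exists_beta_le (h : θ.CommutesWithBeta)
    (hθ : IsCohenSeidenberg θ.toRingHom) (x : PrimeSpectrum R) (y : PrimeSpectrum S)
    (hy : φ.beta x.asIdeal ≤ y.asIdeal.comap θ.toRingHom) :
    ∃ z : PrimeSpectrum S, θ.specMap z = x ∧ ψ.beta z.asIdeal ≤ y.asIdeal := by
  obtain ⟨w, hwy, hw⟩ := hθ.exists_le_comap_eq y (φ.coreMap x) hy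
  obtain ⟨z, hz, rfl⟩ := h.exists_coreMap_eq hθ x w hw
  exact ⟨z, hz, hwy⟩

/-- For the new inclusion, a prime `Q ⊇ β_𝔞 S` contracts to a prime containing some `β_𝔭` with `𝔭 ⊇
𝔞`. Hence `Q` contains `β_z` for a `z` over `𝔭`, and `z ⊇ 𝔞S`. -/
theorem CommutesWithBeta.radical_map_beta [IsNoetherianRing R] (h : θ.CommutesWithBeta)
    (hθ : IsCohenSeidenberg θ.toRingHom) {a : Ideal R} (ha : a.IsRadical) :
    ((φ.beta a).map θ.toRingHom).radical = ψ.beta (a.map θ.toRingHom).radical := by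
  refine (h.radical_map_beta_le a).antisymm ?_
  rw [Ideal.radical_eq_sInf (Ideal.map _ (φ.beta a))]
  refine le_sInf fun Q ⟨hQ, hQ'⟩ => ?_
  rw [Ideal.map_le_iff_le_comap] at hQ
  obtain ⟨x, hax, hx⟩ := φ.exists_beta_le_of_beta_le ha (hQ'.comap θ.toRingHom) hQ
  obtain ⟨z, rfl, hz⟩ := h.exists_beta_le hθ x ⟨Q, hQ'⟩ hx
  exact ((ψ.le_beta_radical_iff _ _).1 le_rfl z (Ideal.map_le_iff_le_comap.2 hax)).trans hz

theorem CommutesWithBeta.preimage_coreMap (h : θ.CommutesWithBeta)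
    (hθ : IsCohenSeidenberg θ.toRingHom) (x : φ.CZpec) :
    θ.specMap ⁻¹' {(φ.coreMap x : PrimeSpectrum R)} =
      (fun y : ψ.CZpec => (ψ.coreMap y : PrimeSpectrum S)) '' (θ.czMap ⁻¹' {x}) := by
  ext y
  constructor
  · exact h.exists_coreMap_eq hθ x y
  · rintro ⟨z, rfl, rfl⟩
    exact h.coreMap_comm z

theorem isQuasiFibered_tfae_of_isCohenSeidenberg [IsNoetherianRing R]
    (hθ : IsCohenSeidenberg θ.toRingHom) :
    [θ.IsQuasiFibered,
      ∀ a : Ideal R, a.IsRadical → ((φ.beta a).map θ.toRingHom).radical =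
        ψ.beta (a.map θ.toRingHom).radical,
      ∀ x : PrimeSpectrum R, ((φ.beta x.asIdeal).map θ.toRingHom).radical =
        ψ.beta (x.asIdeal.map θ.toRingHom).radical,
      ∀ x : φ.CZpec, θ.specMap ⁻¹' {(φ.coreMap x : PrimeSpectrum R)} =
        (fun y : ψ.CZpec => (ψ.coreMap y : PrimeSpectrum S)) '' (θ.czMap ⁻¹' {x}),
      ψ.CSpec = θ.specMap ⁻¹' φ.CSpec].TFAE := by
  rw [isQuasiFibered_iff_commutesWithBeta]
  tfae_have 1 → 2 := fun h a ha => h.radical_map_beta hθ ha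
  tfae_have 2 → 3 := fun h x => h _ x.isPrime.isRadical
  tfae_have 3 → 1 := fun h => θ.commutesWithBeta_of_radical_map_beta_le fun x => (h x).le
  tfae_have 1 → 4 := fun h => h.preimage_coreMap hθ
  tfae_have 4 → 1 := fun h q => by
    have hq : (ψ.coreMap q : PrimeSpectrum S) ∈
        θ.specMap ⁻¹' {(φ.coreMap (θ.czMap q) : PrimeSpectrum R)} := by
      rw [h]
      exact ⟨q, rfl, rfl⟩
    exact congrArg PrimeSpectrum.asIdeal hq
  tfae_have 1 → 5 := fun h => h.CSpec_eq hθ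
  tfae_have 5 → 1 := fun h q => by
    refine (θ.comap_beta_le _).antisymm ?_
    -- Going-down places a prime `z` over `β_{𝔮 ∩ R}` inside `𝔮`; by assumption it is a `ψ`-ideal,
    -- so it even lies in `β_𝔮`.
    obtain ⟨z, hzq, hz⟩ := hθ.exists_le_comap_eq q (φ.coreMap (θ.specMap q)) (φ.beta_le _)
    have hzC : z ∈ ψ.CSpec := by
      rw [h, Set.mem_preimage, specMap, hz]
      exact (φ.coreMap (θ.specMap q)).2
    exact (congrArg PrimeSpectrum.asIdeal hz).ge.trans
      (Ideal.comap_mono (CartierMap.IsPhiIdeal.le_beta hzC hzq))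
  tfae_finish

/-! ### Fibered homomorphisms. -/

/-- Membership in the `F`-pure locus depends only on the core, and on prime `φ`-ideals, which `β`
fixes, it is membership in `Schpec`. -/
theorem CommutesWithBeta.preimage_FPureLocus_eq_iff (h : θ.CommutesWithBeta) (hp : 0 < p) :
    θ.czMap ⁻¹' φ.FPureLocus = ψ.FPureLocus ↔
      θ.cMap ⁻¹' (Subtype.val ⁻¹' φ.Schpec) = (Subtype.val ⁻¹' ψ.Schpec : Set ψ.CSpec) := by
  constructor
  · intro hU
    refine Set.Subset.antisymm (fun y hy => θ.mem_Schpec_of_specMap_mem hp y.2 hy) fun y hy => ?_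
    have h1 := ψ.coreMap_of_mem_CSpec y.1 y.2
    have h2 := hU.symm.subset ((ψ.coreMap_mem_Schpec_iff hp y.1).1 (h1.symm ▸ hy))
    have h3 := (φ.coreMap_mem_Schpec_iff hp (θ.czMap y.1)).2 h2
    have h4 := h.coreMap_comm y.1
    rw [h1] at h4
    change θ.specMap y.1 ∈ φ.Schpec
    rw [h4]
    exact h3
  · intro hS
    refine θ.preimage_FPureLocus_subset.antisymm fun y hy => ?_
    rw [← ψ.coreMap_mem_Schpec_iff hp] at hy
    rw [Set.mem_preimage, ← φ.coreMap_mem_Schpec_iff hp, ← h.coreMap_comm]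
    exact (Set.ext_iff.1 hS (ψ.coreMap y)).2 hy

theorem IsFibered.hasSchwedeSquare (h : θ.IsFibered) (hp : 0 < p) : θ.HasSchwedeSquare := by
  obtain ⟨hc, hU⟩ := h
  have hβ := θ.isQuasiFibered_iff_commutesWithBeta.1 hc
  have hS := (hβ.preimage_FPureLocus_eq_iff hp).1 hU
  exact ⟨fun y hy => hU.symm.subset hy, fun y hy => (Set.ext_iff.1 hS ⟨y, hy.1⟩).2 hy,
    fun y hy => (ψ.coreMap_mem_Schpec_iff hp y).2 hy,
    fun x hx => (φ.coreMap_mem_Schpec_iff hp x).2 hx,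
    Continuous.restrict _ hc,
    Continuous.restrict _ (PrimeSpectrum.continuous_comap θ.toRingHom),
    Continuous.restrict _ ψ.continuous_coreMap,
    Continuous.restrict _ φ.continuous_coreMap,
    funext fun y => Subtype.ext (hβ.coreMap_comm y.1)⟩

theorem IsQuasiFibered.isFibered_tfae (h : θ.IsQuasiFibered) (hp : 0 < p) :
    [θ.IsFibered,
      θ.czMap ⁻¹' φ.FPureLocus = ψ.FPureLocus,
      θ.cMap ⁻¹' (Subtype.val ⁻¹' φ.Schpec) = (Subtype.val ⁻¹' ψ.Schpec : Set ψ.CSpec),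
      θ.HasSchwedeSquare].TFAE := by
  tfae_have 1 ↔ 2 := and_iff_right h
  tfae_have 2 ↔ 3 :=
    (θ.isQuasiFibered_iff_commutesWithBeta.1 h).preimage_FPureLocus_eq_iff hp
  tfae_have 1 → 4 := fun h => h.hasSchwedeSquare hp
  -- The existence of the top arrow already gives the nontrivial inclusion.
  tfae_have 4 → 2 := fun ⟨hU, _⟩ => θ.preimage_FPureLocus_subset.antisymm hU
  tfae_finish

theorem IsQuasiFibered.preimage_Schpec_subset (h : θ.IsQuasiFibered) (hp : 0 < p)
    (hθ : IsCohenSeidenberg θ.toRingHom) : θ.specMap ⁻¹' φ.Schpec ⊆ ψ.Schpec := by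
  intro y hy
  refine θ.mem_Schpec_of_specMap_mem hp ?_ hy
  rw [(θ.isQuasiFibered_iff_commutesWithBeta.1 h).CSpec_eq hθ]
  exact hy.1

theorem IsQuasiFibered.isFibered_iff_preimage_Schpec_eq (h : θ.IsQuasiFibered) (hp : 0 < p)
    (hθ : IsCohenSeidenberg θ.toRingHom) :
    θ.IsFibered ↔ θ.specMap ⁻¹' φ.Schpec = ψ.Schpec := by
  refine ((h.isFibered_tfae hp).out 0 2).trans ⟨?_, ?_⟩
  · intro hS
    exact (h.preimage_Schpec_subset hp hθ).antisymm
      fun y hy => (Set.ext_iff.1 hS ⟨y, hy.1⟩).2 hy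
  · intro hS
    ext y
    exact Set.ext_iff.1 hS y.1

-- By the dichotomy, `κ` is determined by `β` and the `F`-pure locus. Conversely, `β_𝔮 = 𝔮 ∩ κ_𝔮`,
-- and the locus is where `κ ≠ R`, a condition that contraction detects.
variable (θ) in
theorem isFibered_iff_commutesWithKappa (hp : 0 < p) : θ.IsFibered ↔ θ.CommutesWithKappa := by
  rw [IsFibered, isQuasiFibered_iff_commutesWithBeta]
  constructor
  · rintro ⟨h, hU⟩ q
    have hq : φ.kappa (q.asIdeal.comap θ.toRingHom) ≠ ⊤ ↔ ψ.kappa q.asIdeal ≠ ⊤ :=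
      Set.ext_iff.1 hU q
    by_cases ht : ψ.kappa q.asIdeal = ⊤
    · rw [ht, Ideal.comap_top, not_not.1 (mt hq.1 (not_not.2 ht))]
    · rw [ψ.kappa_eq_beta_of_ne_top hp _ ht, φ.kappa_eq_beta_of_ne_top hp _ (hq.2 ht), h q]
  · intro h
    refine ⟨fun q => ?_, ?_⟩
    · rw [CartierMap.beta, CartierMap.beta, Ideal.comap_inf, h q]
    · ext y
      change φ.kappa ((PrimeSpectrum.asIdeal y).comap θ.toRingHom) ≠ ⊤ ↔
        ψ.kappa (PrimeSpectrum.asIdeal y) ≠ ⊤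
      rw [← h y, Ne, Ideal.comap_eq_top_iff]

variable (θ) in
theorem isFibered_tfae (hp : 0 < p) :
    [θ.IsFibered,
      ∀ q : PrimeSpectrum S, (ψ.kappa q.asIdeal).comap θ.toRingHom =
        φ.kappa (q.asIdeal.comap θ.toRingHom),
      ∀ a : Ideal R, ((φ.kappa a).map θ.toRingHom).radical ≤
        ψ.kappa (a.map θ.toRingHom).radical].TFAE := by
  tfae_have 1 ↔ 2 := θ.isFibered_iff_commutesWithKappa hp
  tfae_have 2 → 3 := fun h a => by
    rw [CartierMap.le_kappa_radical_iff]
    intro y hy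
    rw [(ψ.isRadical_kappa hp y.asIdeal).radical_le_iff]
    rw [Ideal.map_le_iff_le_comap] at hy ⊢
    rw [h y]
    exact φ.kappa_mono hy
  tfae_have 3 → 2 := fun h q => by
    refine le_antisymm (θ.comap_kappa_le _) ?_
    rw [← Ideal.map_le_iff_le_comap]
    exact Ideal.le_radical.trans ((ψ.le_kappa_radical_iff _ _).1 (h (q.asIdeal.comap _)) q
      Ideal.map_comap_le)
  tfae_finish

theorem IsFibered.radical_map_kappa [IsNoetherianRing R] (h : θ.IsFibered) (hp : 0 < p)
    (hθ : IsCohenSeidenberg θ.toRingHom) {a : Ideal R} (ha : a.IsRadical) :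
    ((φ.kappa a).map θ.toRingHom).radical = ψ.kappa (a.map θ.toRingHom).radical := by
  have hle : ∀ a : Ideal R, ((φ.kappa a).map θ.toRingHom).radical ≤
      ψ.kappa (a.map θ.toRingHom).radical := ((θ.isFibered_tfae hp).out 0 2).1 h
  refine (hle a).antisymm ?_
  rw [Ideal.radical_eq_sInf (Ideal.map _ (φ.kappa a))]
  refine le_sInf fun Q ⟨hQ, hQ'⟩ => ?_
  rw [Ideal.map_le_iff_le_comap] at hQ
  have hQc := hQ'.comap θ.toRingHom
  obtain ⟨x, hax, hx⟩ := φ.exists_kappa_le_of_kappa_le ha hQc hQ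
  obtain ⟨z, rfl, hz⟩ := (θ.isQuasiFibered_iff_commutesWithBeta.1 h.1).exists_beta_le hθ x
    ⟨Q, hQ'⟩ ((φ.beta_le_kappa _).trans hx)
  refine ((ψ.le_kappa_radical_iff _ _).1 le_rfl z (Ideal.map_le_iff_le_comap.2 hax)).trans ?_
  -- So far only `β_z ⊆ Q` is known. The contraction of `z` has `κ` inside a proper ideal, so
  -- fiberedness puts `z` in the `F`-pure locus, where `κ_z = β_z`.
  have hzU : z ∈ ψ.FPureLocus := by
    rw [← h.2]
    intro ht
    exact hQc.ne_top (top_le_iff.1 (ht.ge.trans hx))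
  exact (ψ.kappa_eq_beta_of_ne_top hp z.asIdeal hzU).le.trans hz

/-! ### Surjective `φ`, and assembly of the theorem. -/

variable (θ) in
theorem isFibered_tfae_of_surjective [IsNoetherianRing R] (hp : 0 < p)
    (hφ : Function.Surjective φ) (hθ : IsCohenSeidenberg θ.toRingHom) :
    [θ.IsFibered,
      Continuous θ.czMap,
      (∀ x, (φ.coreMap x : PrimeSpectrum R) ∈ φ.Schpec) ∧
        (∀ y, (ψ.coreMap y : PrimeSpectrum S) ∈ ψ.Schpec) ∧
        ∀ y, θ.specMap (ψ.coreMap y) = φ.coreMap (θ.czMap y),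
      ∀ x : PrimeSpectrum R, ((φ.beta x.asIdeal).map θ.toRingHom).radical =
        ψ.beta (x.asIdeal.map θ.toRingHom).radical,
      ∀ x : φ.CZpec, θ.specMap ⁻¹' {(φ.coreMap x : PrimeSpectrum R)} =
        (fun y : ψ.CZpec => (ψ.coreMap y : PrimeSpectrum S)) '' (θ.czMap ⁻¹' {x}),
      ψ.Schpec = θ.specMap ⁻¹' φ.Schpec].TFAE := by
  have hUR : ∀ x, x ∈ φ.FPureLocus := fun x =>
    φ.kappa_ne_top_of_surjective hφ (PrimeSpectrum.isPrime x).ne_top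
  -- Purity passes from `R` to `S` through the inclusion valid for every homomorphism.
  have hUS : ∀ y, y ∈ ψ.FPureLocus := fun y => θ.preimage_FPureLocus_subset (hUR _)
  have hCR : φ.Schpec = φ.CSpec := Set.Subset.antisymm (fun x hx => hx.1) fun x hx => by
    rw [← φ.coreMap_of_mem_CSpec x hx]
    exact (φ.coreMap_mem_Schpec_iff hp x).2 (hUR x)
  have hCS : ψ.Schpec = ψ.CSpec := Set.Subset.antisymm (fun y hy => hy.1) fun y hy => by
    rw [← ψ.coreMap_of_mem_CSpec y hy]
    exact (ψ.coreMap_mem_Schpec_iff hp y).2 (hUS y)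
  have hCSeid := isQuasiFibered_tfae_of_isCohenSeidenberg hθ
  rw [hCR, hCS]
  -- Both `F`-pure loci are everything, so fibered and quasi-fibered agree.
  tfae_have 1 ↔ 2 := and_iff_left (Set.ext fun y => iff_of_true (hUR _) (hUS y))
  tfae_have 2 ↔ 4 := hCSeid.out 0 2
  tfae_have 2 ↔ 5 := hCSeid.out 0 3
  tfae_have 2 ↔ 6 := hCSeid.out 0 4
  tfae_have 2 → 3 := fun h => ⟨fun x => (φ.coreMap x).2, fun y => (ψ.coreMap y).2,
    (θ.isQuasiFibered_iff_commutesWithBeta.1 h).coreMap_comm⟩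
  tfae_have 3 → 2 := fun h => θ.isQuasiFibered_iff_commutesWithBeta.2
    fun q => congrArg PrimeSpectrum.asIdeal (h.2.2 q)
  tfae_finish

end

end CartierHom

theorem mainTheorem4 {p e : ℕ} [Fact p.Prime] (he : 0 < e)
    {R : Type u} {S : Type v} [CommRing R] [CommRing S]
    [Algebra (ZMod p) R] [Algebra (ZMod p) S] [IsNoetherianRing R] [IsNoetherianRing S]
    (hR : IsFFinite p R) (hS : IsFFinite p S)
    (φ : CartierMap p e R) (ψ : CartierMap p e S) (θ : CartierHom φ ψ) :
    -- the inclusions that hold for every homomorphism of Cartier pairs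
    ((∀ q : PrimeSpectrum S, (ψ.beta q.asIdeal).comap θ.toRingHom ≤
        φ.beta (q.asIdeal.comap θ.toRingHom)) ∧
      (∀ q : PrimeSpectrum S, (ψ.kappa q.asIdeal).comap θ.toRingHom ≤
        φ.kappa (q.asIdeal.comap θ.toRingHom)) ∧
      ψ.CSpec ⊆ θ.specMap ⁻¹' φ.CSpec ∧
      θ.czMap ⁻¹' φ.FPureLocus ⊆ ψ.FPureLocus ∧
      θ.cMap ⁻¹' (Subtype.val ⁻¹' φ.Schpec) ⊆
        (Subtype.val ⁻¹' ψ.Schpec : Set ψ.CSpec)) ∧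
    -- characterizations of quasi-fibered homomorphisms
    [θ.IsQuasiFibered,
      θ.cMap ∘ ψ.coreMap = φ.coreMap ∘ θ.czMap,
      ∀ q : PrimeSpectrum S, (ψ.beta q.asIdeal).comap θ.toRingHom =
        φ.beta (q.asIdeal.comap θ.toRingHom),
      ∀ a : Ideal R, ((φ.beta a).map θ.toRingHom).radical ≤
        ψ.beta (a.map θ.toRingHom).radical,
      ∀ x : PrimeSpectrum R, ((φ.beta x.asIdeal).map θ.toRingHom).radical ≤
        ψ.beta (x.asIdeal.map θ.toRingHom).radical].TFAE ∧
    (IsCohenSeidenberg θ.toRingHom →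
      [θ.IsQuasiFibered,
        ∀ a : Ideal R, a.IsRadical → ((φ.beta a).map θ.toRingHom).radical =
          ψ.beta (a.map θ.toRingHom).radical,
        ∀ x : PrimeSpectrum R, ((φ.beta x.asIdeal).map θ.toRingHom).radical =
          ψ.beta (x.asIdeal.map θ.toRingHom).radical,
        ∀ x : φ.CZpec, θ.specMap ⁻¹' {(φ.coreMap x : PrimeSpectrum R)} =
          (fun y : ψ.CZpec => (ψ.coreMap y : PrimeSpectrum S)) '' (θ.czMap ⁻¹' {x}),
        ψ.CSpec = θ.specMap ⁻¹' φ.CSpec].TFAE) ∧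
    -- characterizations of fibered homomorphisms among the quasi-fibered ones
    (θ.IsQuasiFibered →
      [θ.IsFibered,
        θ.czMap ⁻¹' φ.FPureLocus = ψ.FPureLocus,
        θ.cMap ⁻¹' (Subtype.val ⁻¹' φ.Schpec) =
          (Subtype.val ⁻¹' ψ.Schpec : Set ψ.CSpec),
        θ.HasSchwedeSquare].TFAE) ∧
    (θ.IsQuasiFibered → IsCohenSeidenberg θ.toRingHom →
      θ.specMap ⁻¹' φ.Schpec ⊆ ψ.Schpec ∧
      (θ.IsFibered ↔ θ.specMap ⁻¹' φ.Schpec = ψ.Schpec)) ∧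
    -- characterizations of fibered homomorphisms through Cartier cores
    [θ.IsFibered,
      ∀ q : PrimeSpectrum S, (ψ.kappa q.asIdeal).comap θ.toRingHom =
        φ.kappa (q.asIdeal.comap θ.toRingHom),
      ∀ a : Ideal R, ((φ.kappa a).map θ.toRingHom).radical ≤
        ψ.kappa (a.map θ.toRingHom).radical].TFAE ∧
    (IsCohenSeidenberg θ.toRingHom → θ.IsFibered →
      ∀ a : Ideal R, a.IsRadical → ((φ.kappa a).map θ.toRingHom).radical =
        ψ.kappa (a.map θ.toRingHom).radical) ∧
    -- the case of `F`-pure pairs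
    (Function.Surjective φ →
      (IsCohenSeidenberg θ.toRingHom ∨
        (IsDomain R ∧ IsIntegrallyClosed R ∧ IsDomain S ∧
          Function.Injective θ.toRingHom ∧ θ.toRingHom.Finite)) →
      [θ.IsFibered,
        Continuous θ.czMap,
        (∀ x, (φ.coreMap x : PrimeSpectrum R) ∈ φ.Schpec) ∧
          (∀ y, (ψ.coreMap y : PrimeSpectrum S) ∈ ψ.Schpec) ∧
          ∀ y, θ.specMap (ψ.coreMap y) = φ.coreMap (θ.czMap y),
        ∀ x : PrimeSpectrum R, ((φ.beta x.asIdeal).map θ.toRingHom).radical =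
          ψ.beta (x.asIdeal.map θ.toRingHom).radical,
        ∀ x : φ.CZpec, θ.specMap ⁻¹' {(φ.coreMap x : PrimeSpectrum R)} =
          (fun y : ψ.CZpec => (ψ.coreMap y : PrimeSpectrum S)) '' (θ.czMap ⁻¹' {x}),
        ψ.Schpec = θ.specMap ⁻¹' φ.Schpec].TFAE) := by
  have hp : 0 < p := (Fact.out : p.Prime).pos
  refine ⟨⟨fun q => θ.comap_beta_le _, fun q => θ.comap_kappa_le _, θ.CSpec_subset,
    θ.preimage_FPureLocus_subset, fun y hy => θ.mem_Schpec_of_specMap_mem hp y.2 hy⟩,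
    θ.isQuasiFibered_tfae, CartierHom.isQuasiFibered_tfae_of_isCohenSeidenberg,
    fun h => h.isFibered_tfae hp,
    fun h hθ => ⟨h.preimage_Schpec_subset hp hθ, h.isFibered_iff_preimage_Schpec_eq hp hθ⟩,
    θ.isFibered_tfae hp, fun hθ h a ha => h.radical_map_kappa hp hθ ha, fun hφ hθ => ?_⟩
  refine θ.isFibered_tfae_of_surjective hp hφ ?_
  rcases hθ with hθ | ⟨_, _, _, hinj, hfin⟩
  · exact hθ
  · exact IsCohenSeidenberg.of_finite hinj hfin
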